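/- Let $R$ be a commutative Noetherian local ring, and let $M$ and $N$ be nonzero finitely generated $R$-modules. Assume that $N$ is Cohen–Macaulay (that is, $\operatorname{depth} N=\dim N$) with $\operatorname{depth} N=\operatorname{depth} R$, that $M$ has finite projective dimension $\operatorname{pd} M$, and that $\operatorname{Supp} M\subseteq\operatorname{Supp} N$. Then $M$ is Cohen–Macaulay if and only if $\operatorname{Ext}^i_R(M,N)=0$ for all integers $i\ge 0$ with $i\neq\operatorname{pd} M$. -/

import Mathlib

universe u

/-- The depth of a module `M` over a local ring `(R, 𝔪)`: the supremum, in `ℕ∞`, of the lengths of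
the (weakly) `M`-regular sequences with entries in `𝔪`. When `R` is Noetherian and `M` is nonzero
and finitely generated, the further requirement `M ≠ (x₁, …, xₙ) M` on an `M`-regular sequence holds
by Nakayama's lemma, see `isRegular_iff_isWeaklyRegular_of_mem_maximalIdeal`. The zero module has
depth `∞`. -/
noncomputable def localDepth (R : Type*) [CommRing R] [IsLocalRing R]
    (M : Type*) [AddCommGroup M] [Module R M] : ℕ∞ :=
  ⨆ (rs : List R) (_ : ∀ r ∈ rs, r ∈ IsLocalRing.maximalIdeal R)
    (_ : RingTheory.Sequence.IsWeaklyRegular M rs), (rs.length : ℕ∞)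

/-- For the modules considered here, weakly regular sequences in the maximal ideal are regular. -/
theorem isRegular_iff_isWeaklyRegular_of_mem_maximalIdeal
    {R : Type*} [CommRing R] [IsLocalRing R]
    {M : Type*} [AddCommGroup M] [Module R M] [Module.Finite R M] [Nontrivial M]
    {rs : List R} (h : ∀ r ∈ rs, r ∈ IsLocalRing.maximalIdeal R) :
    RingTheory.Sequence.IsRegular M rs ↔ RingTheory.Sequence.IsWeaklyRegular M rs := by
  refine ⟨fun H => H.toIsWeaklyRegular, fun H => ⟨H, ?_⟩⟩
  intro htop
  have hle : Ideal.ofList rs ≤ (⊥ : Ideal R).jacobson := by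
    rw [IsLocalRing.jacobson_eq_maximalIdeal ⊥ bot_ne_top]
    exact Ideal.span_le.2 h
  have hbot : (⊤ : Submodule R M) = ⊥ :=
    Submodule.eq_bot_of_le_smul_of_le_jacobson_bot _ _ Module.Finite.fg_top htop.le
      hle
  exact top_ne_bot hbot

/-- A nonzero finitely generated module `M` over a Noetherian local ring is Cohen–Macaulay if
`depth M = dim M`, where `dim M` is the Krull dimension of the support of `M`. (The zero module,
which has depth `∞` and dimension `-∞`, does not satisfy this.) -/
def IsCohenMacaulayModule (R : Type*) [CommRing R] [IsLocalRing R]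
    (M : Type*) [AddCommGroup M] [Module R M] : Prop :=
  (localDepth R M : WithBot ℕ∞) = Module.supportDim R M

/-! Put n = pd M and d = depth N = dim N = depth R. Auslander–Buchsbaum gives depth M = d - n, so M
is Cohen–Macaulay iff dim M ≤ d - n. If this holds, Ischebeck's theorem kills Ext^i(M, N) for i < d
- dim M = n, and projective dimension kills it for i > n. Conversely, vanishing below n yields an
N-regular sequence of length n in Ann M (Rees). Since Supp M ⊆ Supp N, M is supported inside the
quotient of N by that sequence, which has dimension d - n. -/

open CategoryTheory Abelian IsLocalRing RingTheory.Sequence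

/-! ### Vanishing ranges of Ext along short exact sequences. -/

namespace ModuleCat

variable {R : Type u} [CommRing R]

/-- `Ext^i(K, M) = 0` for all `i < n`. -/
def ExtVanishesBelow (K M : ModuleCat.{u} R) (n : ℕ) : Prop :=
  ∀ i < n, Subsingleton (Ext K M i)

namespace ExtVanishesBelow

variable {K : ModuleCat.{u} R}

lemma mono {M : ModuleCat.{u} R} {m n : ℕ} (h : K.ExtVanishesBelow M n) (hmn : m ≤ n) :
    K.ExtVanishesBelow M m :=
  fun i hi ↦ h i (hi.trans_le hmn)

lemma of_retract {M N : ModuleCat.{u} R} (r : Retract M N) {n : ℕ}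
    (h : K.ExtVanishesBelow N n) : K.ExtVanishesBelow M n := by
  intro i hi
  have := h i hi
  refine subsingleton_of_forall_eq 0 fun x ↦ ?_
  have hx : (x.comp (Ext.mk₀ r.i) (add_zero i)).comp (Ext.mk₀ r.r) (add_zero i) = x := by
    simp [Ext.mk₀_comp_mk₀]
  rw [← hx, Subsingleton.elim (x.comp (Ext.mk₀ r.i) (add_zero i)) 0, Ext.zero_comp]

variable {S : ShortComplex (ModuleCat.{u} R)} (hS : S.ShortExact)
include hS

lemma X₃ {n : ℕ} (h₁ : K.ExtVanishesBelow S.X₁ (n + 1)) (h₂ : K.ExtVanishesBelow S.X₂ n) :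
    K.ExtVanishesBelow S.X₃ n := by
  intro i hi
  have := h₁ (i + 1) (by omega)
  have := h₂ i hi
  refine subsingleton_of_forall_eq 0 fun x ↦ ?_
  obtain ⟨y, rfl⟩ := Ext.covariant_sequence_exact₃ K hS x rfl (Subsingleton.elim _ _)
  rw [Subsingleton.elim y 0, Ext.zero_comp]

lemma X₁ {n : ℕ} (h₂ : K.ExtVanishesBelow S.X₂ (n + 1)) (h₃ : K.ExtVanishesBelow S.X₃ n) :
    K.ExtVanishesBelow S.X₁ (n + 1) := by
  intro i hi
  have := h₂ i hi
  refine subsingleton_of_forall_eq 0 fun x ↦ ?_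
  cases i with
  | zero =>
    have := hS.mono_f
    exact Ext.postcomp_mk₀_injective_of_mono K S.f (Subsingleton.elim _ _)
  | succ j =>
    have := h₃ j (by omega)
    obtain ⟨y, rfl⟩ := Ext.covariant_sequence_exact₁ K hS x (Subsingleton.elim _ _) rfl
    rw [Subsingleton.elim y 0, Ext.zero_comp]

/-- The connecting maps onto Ext(K, X₁) are surjective, so nothing need be known about X₂. -/
lemma X₁_of_comp_eq_zero (hf : ∀ (i : ℕ) (x : Ext K S.X₁ i),
    x.comp (Ext.mk₀ S.f) (add_zero i) = 0) {n : ℕ} (h₃ : K.ExtVanishesBelow S.X₃ n) :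
    K.ExtVanishesBelow S.X₁ (n + 1) := by
  intro i hi
  refine subsingleton_of_forall_eq 0 fun x ↦ ?_
  cases i with
  | zero =>
    have := hS.mono_f
    exact Ext.postcomp_mk₀_injective_of_mono K S.f ((hf 0 x).trans (by simp))
  | succ j =>
    have := h₃ j (by omega)
    obtain ⟨y, rfl⟩ := Ext.covariant_sequence_exact₁ K hS x (hf _ x) rfl
    rw [Subsingleton.elim y 0, Ext.zero_comp]

end ExtVanishesBelow

/-- A morphism in `I Hom(M, N)` induces zero on `Ext(K, -)` if `I` annihilates `K`. -/
lemma comp_mk₀_eq_zero_of_mem_smul_top {I : Ideal R} {K M N : ModuleCat.{u} R}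
    (hI : I ≤ Module.annihilator R K) (f : M →ₗ[R] N)
    (hf : f ∈ I • (⊤ : Submodule R (M →ₗ[R] N))) {i : ℕ} (x : Ext K M i) :
    x.comp (Ext.mk₀ (ModuleCat.ofHom f)) (add_zero i) = 0 := by
  induction hf using Submodule.smul_induction_on' with
  | smul r hr g _ =>
    have h0 : r • 𝟙 K = 0 := by
      ext y
      exact Module.mem_annihilator.1 (hI hr) y
    have hx : r • x = 0 := by
      have : r • x = (Ext.mk₀ (r • 𝟙 K)).comp x (zero_add i) := by simp [Ext.mk₀_smul]
      rw [this, h0]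
      simp
    have : ModuleCat.ofHom (r • g) = r • ModuleCat.ofHom g := rfl
    rw [this, Ext.mk₀_smul, Ext.comp_smul, ← Ext.smul_comp, hx, Ext.zero_comp]
  | add f _ g _ hf hg =>
    have : ModuleCat.ofHom (f + g) = ModuleCat.ofHom f + ModuleCat.ofHom g := rfl
    rw [this, Ext.mk₀_add, Ext.comp_add, hf, hg, add_zero]

end ModuleCat

/-! ### Minimal free covers, Nakayama, and Ext into free modules. -/

lemma LinearMap.mem_smul_top_of_range_le {R M N : Type*} [CommRing R] [AddCommGroup M]
    [Module R M] [AddCommGroup N] [Module R N] [Module.Free R M] [Module.Finite R M] {I : Ideal R}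
    (f : M →ₗ[R] N) (hf : f.range ≤ I • (⊤ : Submodule R N)) :
    f ∈ I • (⊤ : Submodule R (M →ₗ[R] N)) := by
  let b := Module.Free.chooseBasis R M
  -- Dual basis expansion: each summand is linear in `f (b i)`, which lies in I N.
  have hsum : f = ∑ i, LinearMap.smulRightₗ (b.coord i) (f (b i)) := by
    refine b.ext fun j ↦ ?_
    simp [LinearMap.sum_apply, Finsupp.single_apply]
  rw [hsum]
  refine Submodule.sum_mem _ fun i _ ↦ ?_
  have : f (b i) ∈ I • (⊤ : Submodule R N) := hf ⟨_, rfl⟩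
  have h := Submodule.mem_map_of_mem (f := LinearMap.smulRightₗ (M₂ := M) (M := N) (b.coord i)) this
  rw [Submodule.map_smul''] at h
  exact Submodule.smul_mono le_rfl le_top h

/-- Minimal free covers of finite modules over local rings. -/
lemma IsLocalRing.exists_minimal_free_cover (R : Type u) [CommRing R] [IsLocalRing R]
    (M : Type u) [AddCommGroup M] [Module R M] [Module.Finite R M] :
    ∃ (ι : Type u) (_ : Finite ι) (f : (ι →₀ R) →ₗ[R] M), Function.Surjective f ∧
      f.ker ≤ maximalIdeal R • (⊤ : Submodule R (ι →₀ R)) := by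
  let b := Module.Free.chooseBasis (ResidueField R) (TensorProduct R (ResidueField R) M)
  have ⟨v, hv⟩ := (TensorProduct.mk_surjective R M (ResidueField R)
    Ideal.Quotient.mk_surjective).comp_left b
  have hv' (i) : (1 : ResidueField R) ⊗ₜ[R] v i = b i := congr_fun hv i
  refine ⟨_, inferInstance, Finsupp.linearCombination R v, ?_, ?_⟩
  · rw [← LinearMap.range_eq_top, Finsupp.range_linearCombination]
    exact span_eq_top_of_tmul_eq_basis v b hv'
  · intro x hx
    have hx0 : ∑ i, residue R (x i) • b i = 0 := by
      have := congr_arg (TensorProduct.mk R (ResidueField R) M 1) (LinearMap.mem_ker.1 hx)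
      rw [Finsupp.linearCombination_apply, Finsupp.sum_fintype _ _ (by simp), map_sum,
        map_zero] at this
      rw [← this]
      refine Finset.sum_congr rfl fun i _ ↦ ?_
      rw [map_smul, TensorProduct.mk_apply, hv', ← algebraMap_smul (ResidueField R) (x i)]
      rfl
    rw [← Finsupp.univ_sum_single x]
    refine Submodule.sum_mem _ fun i _ ↦ ?_
    rw [← mul_one (x i), ← smul_eq_mul, ← Finsupp.smul_single]
    refine Submodule.smul_mem_smul ?_ trivial
    exact (residue_eq_zero_iff _).1 (Fintype.linearIndependent_iff.1 b.linearIndependent _ hx0 i)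

/-- A form of Nakayama's lemma. -/
lemma Submodule.smul_top_lt_top_of_le_maximalIdeal {R : Type*} [CommRing R] [IsLocalRing R]
    {I : Ideal R} (hI : I ≤ maximalIdeal R) (M : Type*) [AddCommGroup M] [Module R M]
    [Module.Finite R M] [Nontrivial M] : I • (⊤ : Submodule R M) < ⊤ := by
  refine lt_top_iff_ne_top.2 fun h ↦ top_ne_bot (α := Submodule R M) ?_
  exact Submodule.eq_bot_of_le_smul_of_le_jacobson_bot _ _ Module.Finite.fg_top h.ge
    (hI.trans (maximalIdeal_le_jacobson _))

namespace ModuleCat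

section

variable {R : Type u} [CommRing R] {K : ModuleCat.{u} R}

lemma ExtVanishesBelow.of_free {n : ℕ} (h : K.ExtVanishesBelow (of R R) n)
    (M : ModuleCat.{u} R) [Module.Free R M] [Module.Finite R M] : K.ExtVanishesBelow M n := by
  intro i hi
  have := h i hi
  refine subsingleton_of_forall_eq 0 fun x ↦ ?_
  let b := Module.Free.chooseBasis R M
  have hid : 𝟙 M = ∑ j, (ofHom (b.coord j) ≫
      (ofHom (LinearMap.toSpanSingleton R M (b j)) : of R R ⟶ M)) := by
    apply ModuleCat.hom_ext
    rw [ModuleCat.hom_sum]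
    refine LinearMap.ext fun m ↦ ?_
    rw [LinearMap.sum_apply]
    exact (b.sum_repr m).symm
  rw [← Ext.comp_mk₀_id x, hid]
  refine Finset.sum_induction _ (fun f ↦ x.comp (Ext.mk₀ f) (add_zero i) = 0)
    (fun f g hf hg ↦ by rw [Ext.mk₀_add, Ext.comp_add, hf, hg, add_zero]) (by simp) fun j _ ↦ ?_
  rw [← Ext.mk₀_comp_mk₀, ← Ext.comp_assoc_of_third_deg_zero,
    Subsingleton.elim (x.comp (Ext.mk₀ (ofHom (b.coord j))) (add_zero i)) 0, Ext.zero_comp]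

lemma extVanishesBelow_iff_of_free (M : ModuleCat.{u} R) [Module.Free R M] [Module.Finite R M]
    [Nontrivial M] {n : ℕ} : K.ExtVanishesBelow M n ↔ K.ExtVanishesBelow (of R R) n := by
  refine ⟨fun h ↦ ?_, fun h ↦ h.of_free M⟩
  let b := Module.Free.chooseBasis R M
  have : Nonempty (Module.Free.ChooseBasisIndex R M) := b.index_nonempty
  let j : Module.Free.ChooseBasisIndex R M := Classical.arbitrary _
  refine ExtVanishesBelow.of_retract (N := M)
    ⟨ofHom (LinearMap.toSpanSingleton R M (b j)), ofHom (b.coord j), ?_⟩ h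
  ext
  simp

end

/-! ### The Auslander–Buchsbaum formula, by induction on projective dimension. -/

section AuslanderBuchsbaum

variable {R : Type u} [CommRing R] [IsLocalRing R] [IsNoetherianRing R]

/-- The Auslander–Buchsbaum formula, with depth expressed by vanishing of `Ext` from the residue
field. -/
theorem extVanishesBelow_residueField_iff_of_hasProjectiveDimensionLE (n : ℕ)
    (M : ModuleCat.{u} R) [Module.Finite R M] (hM : HasProjectiveDimensionLE M n)
    (hM' : ¬ HasProjectiveDimensionLT M n) (m : ℕ) :
    (of R (ResidueField R)).ExtVanishesBelow M m ↔
      (of R (ResidueField R)).ExtVanishesBelow (of R R) (m + n) := by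
  induction n generalizing M m with
  | zero =>
    have : Projective M := (projective_iff_hasProjectiveDimensionLE_zero M).2 hM
    have : Module.Projective R M := (IsProjective.iff_projective M).2 this
    have : Module.Free R M := Module.free_of_flat_of_isLocalRing
    have : Nontrivial M := by
      rwa [hasProjectiveDimensionLT_zero_iff_isZero, isZero_iff_subsingleton,
        not_subsingleton_iff_nontrivial] at hM'
    exact extVanishesBelow_iff_of_free M
  | succ n ih =>
    obtain ⟨ι, _, f, hf, hker⟩ := exists_minimal_free_cover R M
    have hS := LinearMap.shortExact_shortComplexKer hf
    have : Module.Free R f.shortComplexKer.X₂ := inferInstanceAs (Module.Free R (ι →₀ R))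
    have : Module.Finite R f.shortComplexKer.X₂ := inferInstanceAs (Module.Finite R (ι →₀ R))
    have hproj : Projective f.shortComplexKer.X₂ :=
      (IsProjective.iff_projective _).1 inferInstance
    have : Module.Finite R f.shortComplexKer.X₁ := inferInstanceAs (Module.Finite R f.ker)
    have hK : HasProjectiveDimensionLE f.shortComplexKer.X₁ n :=
      (hS.hasProjectiveDimensionLT_X₃_iff n hproj).1 hM
    have hK' : ¬ HasProjectiveDimensionLT f.shortComplexKer.X₁ n := fun h ↦
      hM' (hS.hasProjectiveDimensionLT_X₃ n h (hasProjectiveDimensionLT_of_ge _ 1 _ (by omega)))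
    have key := ih f.shortComplexKer.X₁ hK hK'
    have hmn : m + (n + 1) = m + 1 + n := by omega
    rw [hmn, ← key (m + 1)]
    refine ⟨fun h ↦ ?_, fun h ↦ .X₃ hS h ?_⟩
    -- If pd M = 1 the kernel is free and the long exact sequence alone would be circular;
    -- minimality of the cover makes the map into it zero on Ext from the residue field.
    · cases n with
      | zero =>
        have : Projective f.shortComplexKer.X₁ :=
          (projective_iff_hasProjectiveDimensionLE_zero _).2 hK
        have : Module.Projective R f.shortComplexKer.X₁ := (IsProjective.iff_projective _).2 this
        have : Module.Free R f.shortComplexKer.X₁ :=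
          Module.free_of_flat_of_isLocalRing (P := f.shortComplexKer.X₁)
        refine .X₁_of_comp_eq_zero hS (fun i x ↦ ?_) h
        have hann : maximalIdeal R ≤ Module.annihilator R (of R (ResidueField R)) :=
          (Ideal.annihilator_quotient (I := maximalIdeal R)).ge
        refine comp_mk₀_eq_zero_of_mem_smul_top (I := maximalIdeal R) hann f.shortComplexKer.f.hom
          (LinearMap.mem_smul_top_of_range_le _ ?_) x
        exact (Submodule.range_subtype f.ker).trans_le hker
      | succ n =>
        -- Bootstrapping: vanishing below j for the kernel, of positive projective dimension, gives
        -- vanishing below j + 1 for R, hence for the cover, and so for the kernel.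
        have step : ∀ j ≤ m + 1,
            (of R (ResidueField R)).ExtVanishesBelow f.shortComplexKer.X₁ j := by
          intro j
          induction j with
          | zero => exact fun _ i hi ↦ absurd hi (by omega)
          | succ j hj =>
            intro hjm
            have h1 := (key j).1 (hj (by omega))
            exact .X₁ hS ((h1.mono (by omega)).of_free _) (h.mono (by omega))
        exact step _ le_rfl
    · exact (((key (m + 1)).1 h).mono (by omega)).of_free _

end AuslanderBuchsbaum

/-! ### Depth through Ext, and its comparison with dimension. -/

section Depth

variable {R : Type u} [CommRing R] [IsLocalRing R] [IsNoetherianRing R]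

/-- Rees's characterisation, applied to the residue field, whose support is the closed point. -/
lemma natCast_le_localDepth_iff (M : ModuleCat.{u} R) [Module.Finite R M] [Nontrivial M] (n : ℕ) :
    (n : ℕ∞) ≤ localDepth R M ↔ (of R (ResidueField R)).ExtVanishesBelow M n := by
  have hlt : maximalIdeal R • (⊤ : Submodule R M) < ⊤ :=
    Submodule.smul_top_lt_top_of_le_maximalIdeal le_rfl M
  have hsupp : Module.support R (of R (ResidueField R)) =
      PrimeSpectrum.zeroLocus (maximalIdeal R) := by
    rw [Module.support_eq_zeroLocus]
    congr 2
    exact Ideal.annihilator_quotient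
  constructor
  · intro h
    cases n with
    | zero => exact fun i hi ↦ absurd hi (by omega)
    | succ n =>
      have hn : (n : ℕ∞) < localDepth R M :=
        (ENat.natCast_lt_natCast.2 n.lt_succ_self).trans_le h
      simp only [localDepth, lt_iSup_iff, ENat.natCast_lt_natCast] at hn
      obtain ⟨rs, hmem, hreg, hlen⟩ := hn
      intro i hi
      exact subsingleton_ext_of_exists_isRegular (maximalIdeal R) _ hsupp.subset M hlt rs hmem
        ((isRegular_iff_isWeaklyRegular_of_mem_maximalIdeal hmem).2 hreg) i (by omega)
  · intro h
    obtain ⟨rs, rfl, hmem, hreg⟩ := exists_isRegular_of_exists_subsingleton_ext (maximalIdeal R) n M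
      hlt (of R (ResidueField R)) hsupp h
    exact le_iSup_of_le rs (le_iSup_of_le hmem (le_iSup_of_le hreg.toIsWeaklyRegular le_rfl))

lemma localDepth_le_supportDim (M : Type u) [AddCommGroup M] [Module R M] [Module.Finite R M]
    [Nontrivial M] : (localDepth R M : WithBot ℕ∞) ≤ Module.supportDim R M := by
  have h0 := Module.supportDim_ne_bot_of_nontrivial R M
  obtain ⟨d, hd⟩ := WithBot.ne_bot_iff_exists.1 h0
  rw [← hd, WithBot.coe_le_coe]
  refine iSup_le fun rs ↦ iSup_le fun hmem ↦ iSup_le fun hreg ↦ ?_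
  have hreg' := (isRegular_iff_isWeaklyRegular_of_mem_maximalIdeal hmem).2 hreg
  have hdim := Module.supportDim_add_length_eq_supportDim_of_isRegular rs hreg'
  have := hreg'.quot_ofList_smul_nontrivial
  obtain ⟨e, he⟩ := WithBot.ne_bot_iff_exists.1 (Module.supportDim_ne_bot_of_nontrivial R
    (M ⧸ Ideal.ofList rs • (⊤ : Submodule R M)))
  rw [← hd, ← he] at hdim
  have : e + rs.length = d := by exact_mod_cast hdim
  rw [← this]
  exact le_add_self

/-- Auslander–Buchsbaum. -/
theorem localDepth_add_eq_of_projectiveDimension_eq (M : ModuleCat.{u} R) [Module.Finite R M]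
    [Nontrivial M] {n : ℕ} (hn : projectiveDimension M = n) :
    localDepth R M + n = localDepth R R := by
  have hLE : HasProjectiveDimensionLE M n := (projectiveDimension_le_iff M n).1 hn.le
  have hLT : ¬ HasProjectiveDimensionLT M n := (projectiveDimension_ge_iff M n).1 hn.ge
  have key (m : ℕ) : (m : ℕ∞) ≤ localDepth R M ↔ ((m + n : ℕ) : ℕ∞) ≤ localDepth R R := by
    rw [natCast_le_localDepth_iff M, natCast_le_localDepth_iff (of R R)]
    exact extVanishesBelow_residueField_iff_of_hasProjectiveDimensionLE n M hLE hLT m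
  -- The case m = 0 settles every j ≤ n, which `key` does not reach.
  have hnR : (n : ℕ∞) ≤ localDepth R R := by simpa using (key 0).1 (by simp)
  refine ENat.eq_of_forall_natCast_le_iff fun j ↦ ?_
  rcases le_total n j with h | h
  · obtain ⟨m, rfl⟩ := Nat.exists_eq_add_of_le' h
    rw [← key, Nat.cast_add]
    exact ENat.add_le_add_iff_right (ENat.natCast_ne_top n)
  · have : (j : ℕ∞) ≤ n := by exact_mod_cast h
    exact iff_of_true (this.trans le_add_self) (this.trans hnR)

end Depth

/-! ### Ischebeck's theorem. -/

section Ischebeck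

variable {R : Type u} [CommRing R] [IsLocalRing R] [IsNoetherianRing R]

/-- The long exact sequence makes x surjective on the finitely generated module Ext^i(M, N);
Nakayama concludes. -/
lemma subsingleton_ext_of_isSMulRegular {M N : ModuleCat.{u} R} [Module.Finite R M]
    [Module.Finite R N] {x : R} (hx : IsSMulRegular M x) (hxm : x ∈ maximalIdeal R) {i : ℕ}
    (h : Subsingleton (Ext (of R (QuotSMulTop x M)) N (i + 1))) : Subsingleton (Ext M N i) := by
  have hS := hx.smulShortComplex_shortExact
  by_contra hne
  rw [not_subsingleton_iff_nontrivial] at hne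
  have hmem : x ∈ (Module.annihilator R (Ext M N i)).jacobson := maximalIdeal_le_jacobson _ hxm
  refine Submodule.top_ne_pointwise_smul_of_mem_jacobson_annihilator hmem (le_antisymm ?_ le_top)
  intro y _
  have : Subsingleton (Ext (M.smulShortComplex x).X₃ N (1 + i)) := by rw [add_comm]; exact h
  obtain ⟨z, hz⟩ : ∃ z : Ext M N i, (Ext.mk₀ (x • 𝟙 M)).comp z (zero_add i) = y :=
    Ext.contravariant_sequence_exact₁ hS N y rfl (Subsingleton.elim _ _)
  rw [Ext.mk₀_smul, Ext.smul_comp, Ext.mk₀_id_comp] at hz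
  rw [← hz]
  exact Submodule.smul_mem_pointwise_smul _ _ _ trivial

/-- The case of Ischebeck's theorem in which `M` is supported at the closed point. -/
lemma subsingleton_ext_of_support_subset_zeroLocus_maximalIdeal {M N : ModuleCat.{u} R}
    [Module.Finite R M] [Module.Finite R N] [Nontrivial N]
    (hM : Module.support R M ⊆ PrimeSpectrum.zeroLocus (maximalIdeal R)) {i : ℕ}
    (hi : (i : ℕ∞) < localDepth R N) : Subsingleton (Ext M N i) := by
  simp only [localDepth, lt_iSup_iff, ENat.natCast_lt_natCast] at hi
  obtain ⟨rs, hmem, hreg, hlen⟩ := hi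
  exact subsingleton_ext_of_exists_isRegular (maximalIdeal R) _ hM N
    (Submodule.smul_top_lt_top_of_le_maximalIdeal le_rfl N) rs hmem
    ((isRegular_iff_isWeaklyRegular_of_mem_maximalIdeal hmem).2 hreg) i hlen

/-- Ischebeck's theorem: `Ext^i(M, N) = 0` for `i + dim M < depth N`. -/
theorem subsingleton_ext_of_add_supportDim_lt (N : ModuleCat.{u} R) [Module.Finite R N]
    [Nontrivial N] (r : ℕ) (M : ModuleCat.{u} R) [Module.Finite R M]
    (hr : Module.supportDim R M ≤ r) (i : ℕ) (hi : ((i + r : ℕ) : ℕ∞) < localDepth R N) :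
    Subsingleton (Ext M N i) := by
  induction r generalizing M i with
  | zero =>
    refine subsingleton_ext_of_support_subset_zeroLocus_maximalIdeal ?_ (by simpa using hi)
    rcases subsingleton_or_nontrivial M with h | h
    · simp [Module.support_eq_empty]
    · have h0 : (0 : WithBot ℕ∞) ≤ Module.supportDim R M := by
        have : Nonempty (Module.support R M) := Module.nonempty_support_of_nontrivial.to_subtype
        exact Order.krullDim_nonneg
      exact (support_of_supportDim_eq_zero R M (le_antisymm (by simpa using hr) h0)).subset
  | succ r ih =>
    suffices H : ∀ (M : Type u) [AddCommGroup M] [Module R M], Module.Finite R M →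
        Module.supportDim R M ≤ (r + 1 : ℕ) → Subsingleton (Ext (of R M) N i) from
      H M inferInstance hr
    intro M _ _ hfin
    -- Prime filtration reduces to R/p. For p not maximal, dividing by some x in 𝔪 outside p lowers
    -- the dimension by one and raises i by one, preserving their sum.
    induction hfin using IsNoetherianRing.induction_on_isQuotientEquivQuotientPrime R with
    | subsingleton M =>
      intro _
      have : Limits.IsZero (of R M) := by
        rw [isZero_iff_subsingleton]; assumption
      have := this.hasProjectiveDimensionLT_zero
      exact HasProjectiveDimensionLT.subsingleton (of R M) 0 i (Nat.zero_le _) N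
    | quotient M p e =>
      intro hdim
      have hi' : (i : ℕ∞) < localDepth R N :=
        lt_of_le_of_lt (by exact_mod_cast Nat.le_add_right i (r + 1)) hi
      by_cases hp : p.asIdeal = maximalIdeal R
      · refine subsingleton_ext_of_support_subset_zeroLocus_maximalIdeal ?_ hi'
        change Module.support R M ⊆ _
        rw [e.support_eq, Module.support_eq_zeroLocus, Ideal.annihilator_quotient, hp]
      · obtain ⟨x, hxm, hxp⟩ := SetLike.exists_of_lt
          (lt_of_le_of_ne (le_maximalIdeal p.2.ne_top) hp)
        have hx : IsSMulRegular M x := by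
          rw [e.isSMulRegular_congr, isSMulRegular_iff_right_eq_zero_of_smul]
          intro y hy
          obtain ⟨y, rfl⟩ := Ideal.Quotient.mk_surjective y
          rw [Algebra.smul_def, Ideal.Quotient.algebraMap_eq, ← map_mul,
            Ideal.Quotient.eq_zero_iff_mem] at hy
          exact Ideal.Quotient.eq_zero_iff_mem.2 ((p.2.mem_or_mem hy).resolve_left hxp)
        refine subsingleton_ext_of_isSMulRegular (M := of R M) hx hxm (ih _ ?_ _ ?_)
        · change Module.supportDim R (QuotSMulTop x M) ≤ r
          rw [← Module.supportDim_quotSMulTop_succ_eq_supportDim hx hxm, Nat.cast_add,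
            Nat.cast_one] at hdim
          exact (ENat.WithBot.add_le_add_one_right_iff).1 hdim
        · rwa [show i + 1 + r = i + (r + 1) by omega]
    | exact M₁ M₂ M₃ f g hf hg hfg h₁ h₃ =>
      intro hdim
      have := h₁ ((Module.supportDim_le_of_injective f hf).trans hdim)
      have := h₃ ((Module.supportDim_le_of_surjective g hg).trans hdim)
      let S : ShortComplex (ModuleCat.{u} R) :=
        ShortComplex.mk (ofHom f) (ofHom g) (by ext; simp [hfg.apply_apply_eq_zero])
      have hS : S.ShortExact :=
        { exact := (ShortComplex.ShortExact.moduleCat_exact_iff_function_exact S).2 hfg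
          mono_f := (mono_iff_injective _).2 hf
          epi_g := (epi_iff_surjective _).2 hg }
      refine subsingleton_of_forall_eq 0 fun (x : Ext S.X₂ N i) ↦ ?_
      have : Subsingleton (Ext S.X₁ N i) := ‹Subsingleton (Ext (of R M₁) N i)›
      have : Subsingleton (Ext S.X₃ N i) := ‹Subsingleton (Ext (of R M₃) N i)›
      obtain ⟨y, rfl⟩ := Ext.contravariant_sequence_exact₂ hS N x (Subsingleton.elim _ _)
      rw [Subsingleton.elim y 0, Ext.comp_zero]

end Ischebeck

end ModuleCat

/-! ### The Cohen–Macaulay criterion. -/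

theorem corollary1p6 {R : Type u} [CommRing R] [IsLocalRing R] [IsNoetherianRing R]
    {M N : Type u} [AddCommGroup M] [Module R M] [Module.Finite R M] [Nontrivial M]
    [AddCommGroup N] [Module R N] [Module.Finite R N] [Nontrivial N]
    (hN : IsCohenMacaulayModule R N)
    (hdepth : localDepth R N = localDepth R R)
    (hpd : CategoryTheory.projectiveDimension (ModuleCat.of R M) ≠ ⊤)
    (hsupp : Module.support R M ⊆ Module.support R N) :
    IsCohenMacaulayModule R M ↔
      ∀ i : ℕ, (i : WithBot ℕ∞) ≠ CategoryTheory.projectiveDimension (ModuleCat.of R M) →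
        Subsingleton (CategoryTheory.Abelian.Ext (ModuleCat.of R M) (ModuleCat.of R N) i) := by
  obtain ⟨n, hn⟩ : ∃ n : ℕ, projectiveDimension (ModuleCat.of R M) = n := by
    have hbot : projectiveDimension (ModuleCat.of R M) ≠ ⊥ := by
      rw [Ne, projectiveDimension_eq_bot_iff, ModuleCat.isZero_iff_subsingleton,
        not_subsingleton_iff_nontrivial]
      assumption
    obtain ⟨e, he⟩ := WithBot.ne_bot_iff_exists.1 hbot
    rw [← he] at hpd ⊢
    obtain ⟨n, rfl⟩ := ENat.ne_top_iff_exists.1 (fun h : e = ⊤ ↦ hpd (by rw [h]; rfl))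
    exact ⟨n, rfl⟩
  have hAB := ModuleCat.localDepth_add_eq_of_projectiveDimension_eq (ModuleCat.of R M) hn
  -- Finiteness of depth N = dim N ≤ dim R permits arithmetic in ℕ.
  have hNfin : localDepth R N ≠ ⊤ := by
    intro h
    have h1 := Module.supportDim_le_ringKrullDim R N
    rw [← hN, h] at h1
    exact ringKrullDim_ne_top (R := R) (top_le_iff.1 h1)
  obtain ⟨d, hd⟩ := ENat.ne_top_iff_exists.1 hNfin
  rw [← hdepth, ← hd] at hAB
  obtain ⟨e, he⟩ := ENat.ne_top_iff_exists.1
    (fun h : localDepth R M = ⊤ ↦ by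
      change localDepth R M + n = d at hAB
      rw [h, top_add] at hAB
      exact ENat.natCast_ne_top d hAB.symm)
  change localDepth R M + n = d at hAB
  rw [← he] at hAB
  have hed : e + n = d := by exact_mod_cast hAB
  simp only [hn, ne_eq, Nat.cast_inj]
  constructor
  · intro hM i hi
    rcases lt_or_gt_of_ne (fun h : i = n ↦ hi (by rw [h])) with h | h
    · refine ModuleCat.subsingleton_ext_of_add_supportDim_lt (ModuleCat.of R N) e
        (ModuleCat.of R M) ?_ i ?_
      · change Module.supportDim R M ≤ e
        rw [← hM, ← he]
        rfl
      · change _ < localDepth R N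
        rw [← hd]
        exact_mod_cast (by omega : i + e < d)
    · have := (projectiveDimension_lt_iff (X := ModuleCat.of R M) (n := i)).1
        (by rw [hn]; exact_mod_cast h)
      exact HasProjectiveDimensionLT.subsingleton (ModuleCat.of R M) i i le_rfl _
  · intro h
    have hann : Module.annihilator R M ≤ maximalIdeal R :=
      le_maximalIdeal (fun h ↦ not_subsingleton M (Module.annihilator_eq_top_iff.1 h))
    obtain ⟨rs, hlen, hmem, hreg⟩ := ModuleCat.exists_isRegular_of_exists_subsingleton_ext
      (Module.annihilator R M) n (ModuleCat.of R N)
      (Submodule.smul_top_lt_top_of_le_maximalIdeal hann N) (ModuleCat.of R M)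
      (Module.support_eq_zeroLocus (R := R) (M := M))
      (fun i hi ↦ h i (fun hin ↦ hi.ne (by exact_mod_cast hin)))
    have hdim := Module.supportDim_add_length_eq_supportDim_of_isRegular rs hreg
    -- The support of the quotient is Supp N ∩ V(rs), and `rs` lies in Ann M.
    have hsub : Module.support R M ⊆
        Module.support R (N ⧸ Ideal.ofList rs • (⊤ : Submodule R N)) := by
      rw [Module.support_quotient]
      refine Set.subset_inter hsupp ?_
      rw [Module.support_eq_zeroLocus]
      exact PrimeSpectrum.zeroLocus_anti_mono_ideal (Ideal.span_le.2 hmem)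
    have hle : Module.supportDim R M ≤
        Module.supportDim R (N ⧸ Ideal.ofList rs • (⊤ : Submodule R N)) :=
      Order.krullDim_le_of_strictMono (fun a ↦ ⟨a.1, hsub a.2⟩) (fun _ _ lt ↦ lt)
    have hfinal : Module.supportDim R M + n ≤ (e : WithBot ℕ∞) + n := by
      have h1 : (e : WithBot ℕ∞) + n = Module.supportDim R N := by
        rw [← hN, ← hd, ← hed]; rfl
      rw [h1, ← hlen]
      exact (add_le_add_left hle _).trans hdim.le
    refine le_antisymm (ModuleCat.localDepth_le_supportDim M) ?_
    rw [← he]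
    exact ENat.WithBot.add_le_add_natCast_right_iff.1 hfinal
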